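/- Let $D\subsetneq\mathbb{C}$ be a simply connected domain, and let $\lambda_D$ be the density of its hyperbolic metric of curvature $-4$, i.e. $\lambda_D(\varphi(\zeta))\,|\varphi'(\zeta)|=1/(1-|\zeta|^2)$ for a conformal map $\varphi$ of the unit disk $\mathbb{D}$ onto $D$. For a harmonic mapping $f$ in $D$ with positive Jacobian $J_f$, put $P_f=(\log J_f)_z=\frac{\partial}{\partial z}\log J_f$ and $\|P_f\|_D=\sup_{z\in D}\lambda_D(z)^{-1}|P_f(z)|\in[0,\infty]$; for a locally univalent analytic $f$ this gives $P_f=f''/f'$. Let $f=h+\overline{g}$, with $h,g$ analytic in $D$, be a sense-preserving harmonic mapping in $D$ (that is, $J_f=|h'|^2-|g'|^2>0$ in $D$), with dilatation $\omega_f=g'/h'$. Then for each $\varepsilon\in\overline{\mathbb{D}}$ we have $$\lambda_D(z)^{-1}\,\bigl|P_{h+\varepsilon g}(z)-P_f(z)\bigr|\le\sup_{\zeta\in D}|\omega_f(\zeta)|,\qquad z\in D. \tag{1}$$ Moreover, either $\|P_{h+\varepsilon g}\|_D=\|P_f\|_D=\infty$, or both $\|P_{h+\varepsilon g}\|_D$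 and $\|P_f\|_D$ are finite. If $\|P_f\|_D<\infty$, then $$\bigl|\,\|P_{h+\varepsilon g}\|_D-\|P_f\|_D\,\bigr|\le\sup_{\zeta\in D}|\omega_f(\zeta)|. \tag{2}$$ Furthermore, for every $k\in[0,1]$ there exist $\varepsilon_k\in\overline{\mathbb{D}}$ and a sense-preserving harmonic mapping $F_k=H_k+\overline{G_k}$ in $D$ with $\sup_{z\in D}|\omega_{F_k}(z)|=k$ such that, for $f=F_k$ and $\varepsilon=\varepsilon_k$, equality holds in (1) at some point $z\in D$, and, when $D$ is a disk, both norms in (2) are finite and equality holds in (2). -/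

import Mathlib

open Set Metric
open scoped ENNReal ComplexConjugate

noncomputable section

/-- `φ` maps the open unit disk conformally (holomorphically and bijectively) onto `D`. -/
def IsConformalDiskMap (φ : ℂ → ℂ) (D : Set ℂ) : Prop :=
  DifferentiableOn ℂ φ (ball 0 1) ∧ BijOn φ (ball 0 1) D

open Classical in
/-- The density `λ_D` of the hyperbolic metric (curvature `-4`) of a simply connected domain
`D ≠ ℂ`: it is determined by `λ_D (φ ζ) * |φ' ζ| = 1 / (1 - |ζ|²)`, where `φ` is a conformal map of
the unit disk onto `D`. The value does not depend on the choice of `φ`, since two such maps differ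
by a conformal automorphism of the unit disk. -/
def hyperbolicDensity (D : Set ℂ) (z : ℂ) : ℝ :=
  if h : ∃ p : (ℂ → ℂ) × ℂ, IsConformalDiskMap p.1 D ∧ p.2 ∈ ball (0 : ℂ) 1 ∧ p.1 p.2 = z then
    1 / ((1 - ‖h.choose.2‖ ^ 2) * ‖deriv h.choose.1 h.choose.2‖)
  else 0

/-- The Wirtinger derivative `u_z = (u_x - i u_y) / 2`. -/
def wirtingerDeriv (u : ℂ → ℂ) (z : ℂ) : ℂ :=
  (fderiv ℝ u z 1 - Complex.I * fderiv ℝ u z Complex.I) / 2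

/-- The Jacobian `J_f`, the determinant of the real derivative of `f`. -/
def jacobian (f : ℂ → ℂ) (z : ℂ) : ℝ := (fderiv ℝ f z).det

/-- The harmonic pre-Schwarzian derivative `P_f = (log J_f)_z`. -/
def preSchwarzian (f : ℂ → ℂ) (z : ℂ) : ℂ :=
  wirtingerDeriv (fun w => ((Real.log (jacobian f w) : ℝ) : ℂ)) z

/-- The pre-Schwarzian norm `‖P_f‖_D = sup_{z ∈ D} λ_D(z)⁻¹ |P_f(z)|`, possibly infinite. -/
def preSchwarzianNorm (f : ℂ → ℂ) (D : Set ℂ) : ℝ≥0∞ :=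
  ⨆ z ∈ D, ENNReal.ofReal ((hyperbolicDensity D z)⁻¹ * ‖preSchwarzian f z‖)

/-- `f` is a sense-preserving harmonic mapping in `D`: it is harmonic with positive Jacobian, and
`h`, `g` are analytic functions in `D` with `f = h + conj g` there. -/
structure IsSensePreservingHarmonic (f h g : ℂ → ℂ) (D : Set ℂ) : Prop where
  harmonic : InnerProductSpace.HarmonicOnNhd f D
  jacobian_pos : ∀ z ∈ D, 0 < jacobian f z
  analytic_h : DifferentiableOn ℂ h D
  analytic_g : DifferentiableOn ℂ g D
  decomposition : ∀ z ∈ D, f z = h z + conj (g z)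

/-- The dilatation `ω_f = g' / h'` of `f = h + conj g`. -/
def dilatation (h g : ℂ → ℂ) (z : ℂ) : ℂ := deriv g z / deriv h z

/-- `sup_{z ∈ D} |ω_f(z)|`; for a sense-preserving `f` this is the supremum of a set of reals
bounded by `1`. -/
def supDilatation (h g : ℂ → ℂ) (D : Set ℂ) : ℝ :=
  sSup ((fun z => ‖dilatation h g z‖) '' D)

end

open Filter Topology

/-! Write `a = h'`, `b = g'`. Since `J_f = |a|² - |b|²`, a direct computation gives `P_{h+εg} - P_f
= (b'a - ba')(b̄ + εā) / ((|a|² - |b|²)(a + εb))`, whose modulus is `|ω'| / (1 - |ω|²)` times `|b̄ +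
εā| / |a + εb|` (`norm_preSchwarzian_sub`). The last quotient is at most 1 because `|a + εb|² - |b̄
+ εā|² = (1 - |ε|²)(|a|² - |b|²)`. What remains is the hyperbolic derivative of `ω`, bounded by `sup
|ω|` through a Schwarz-Pick inequality that keeps track of the supremum
(`norm_deriv_mul_le_mul_of_norm_le`). The claims about norms follow by the triangle inequality.

For sharpness take `ε = 1` and a conformal map `φ` of the disk onto `D`. Prescribe `ω(φ(ζ)) = kζ`
and `H + G = z`. Then `P_{H+G} = 0`, both factors above are extremal at `φ(0)`, and hence `‖P_F‖ =
k`. The existence of `φ` is the Riemann mapping theorem, proved here by Koebe's extremal argument.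
-/

/-! ### Injective holomorphic functions and their inverses -/

theorem DifferentiableOn.nhds_le_map_of_injOn {f : ℂ → ℂ} {U : Set ℂ} (hU : IsOpen U)
    (hf : DifferentiableOn ℂ f U) (hi : InjOn f U) {z : ℂ} (hz : z ∈ U) :
    𝓝 (f z) ≤ map f (𝓝 z) := by
  rcases (hf.analyticAt (hU.mem_nhds hz)).eventually_constant_or_nhds_le_map_nhds with h | h
  · exfalso
    have h1 : ∀ᶠ w in 𝓝[≠] z, w = z := by
      filter_upwards [nhdsWithin_le_nhds h, nhdsWithin_le_nhds (hU.mem_nhds hz)] with w hw hwU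
      exact hi hwU hz hw
    have h2 : ∀ᶠ w in 𝓝[≠] z, w ≠ z := eventually_mem_nhdsWithin
    obtain ⟨w, hw1, hw2⟩ := (h1.and h2).exists
    exact hw2 hw1
  · exact h

theorem DifferentiableOn.isOpen_image_of_injOn {f : ℂ → ℂ} {U : Set ℂ} (hU : IsOpen U)
    (hf : DifferentiableOn ℂ f U) (hi : InjOn f U) : IsOpen (f '' U) := by
  rw [isOpen_iff_mem_nhds]
  rintro _ ⟨z, hz, rfl⟩
  exact hf.nhds_le_map_of_injOn hU hi hz (image_mem_map (hU.mem_nhds hz))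

theorem DifferentiableOn.continuousAt_leftInverse {f g : ℂ → ℂ} {U : Set ℂ} (hU : IsOpen U)
    (hf : DifferentiableOn ℂ f U) (hi : InjOn f U) (hg : LeftInvOn g f U) {z : ℂ} (hz : z ∈ U) :
    ContinuousAt g (f z) := by
  have h1 : map g (𝓝 (f z)) ≤ map g (map f (𝓝 z)) := map_mono (hf.nhds_le_map_of_injOn hU hi hz)
  refine h1.trans ?_
  rw [map_map, hg hz]
  have : g ∘ f =ᶠ[𝓝 z] id := by
    filter_upwards [hU.mem_nhds hz] with w hw using hg hw
  rw [map_congr this, map_id]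

theorem DifferentiableOn.hasDerivAt_leftInverse_of_injOn {f g : ℂ → ℂ} {U : Set ℂ} (hU : IsOpen U)
    (hf : DifferentiableOn ℂ f U) (hi : InjOn f U) (hg : LeftInvOn g f U) {z : ℂ} (hz : z ∈ U)
    (h0 : _root_.deriv f z ≠ 0) : HasDerivAt g (_root_.deriv f z)⁻¹ (f z) := by
  have hc := hf.continuousAt_leftInverse hU hi hg hz
  refine HasDerivAt.of_local_left_inverse (f := f) hc ?_ h0 ?_
  · rw [hg hz]
    exact (hf.differentiableAt (hU.mem_nhds hz)).hasDerivAt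
  · have hV := (hf.isOpen_image_of_injOn hU hi).mem_nhds (mem_image_of_mem f hz)
    filter_upwards [hV]
    rintro _ ⟨w, hw, rfl⟩
    rw [hg hw]

/-- Critical points of a nonconstant function are isolated. Away from their images the inverse
function rule applies; at such an image the inverse is continuous, so the singularity is removable.
That `f'` has no zeros is then a consequence, by the chain rule. -/
theorem DifferentiableOn.differentiableOn_leftInverse {f g : ℂ → ℂ} {U : Set ℂ} (hU : IsOpen U)
    (hf : DifferentiableOn ℂ f U) (hi : InjOn f U) (hg : LeftInvOn g f U) :
    DifferentiableOn ℂ g (f '' U) := by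
  rintro _ ⟨z, hz, rfl⟩
  have hV := hf.isOpen_image_of_injOn hU hi
  have hc := hf.continuousAt_leftInverse hU hi hg hz
  refine (Complex.analyticAt_of_differentiable_on_punctured_nhds_of_continuousAt ?_
    hc).differentiableAt.differentiableWithinAt
  have hfa : AnalyticAt ℂ f z := hf.analyticAt (hU.mem_nhds hz)
  have key : ∀ᶠ w in 𝓝[≠] z, _root_.deriv f w ≠ 0 := by
    rcases hfa.deriv.eventually_eq_zero_or_eventually_ne_zero with h | h
    · exfalso
      obtain ⟨r, hr, hrU⟩ := Metric.eventually_nhds_iff_ball.1 (h.and (hU.mem_nhds hz))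
      obtain ⟨w, hw, hwz⟩ : ∃ w ∈ ball z r, w ≠ z := by
        refine ⟨z + (r / 2 : ℝ), ?_, ?_⟩
        · simp [abs_of_pos hr]; linarith
        · simp; exact hr.ne'
      apply hwz
      refine hi (hrU w hw).2 hz ?_
      exact (convex_ball z r).is_const_of_fderivWithin_eq_zero (𝕜 := ℂ)
        (hf.mono fun x hx => (hrU x hx).2) (fun x hx => by
          rw [fderivWithin_of_isOpen isOpen_ball hx]
          ext
          simpa using (hrU x hx).1) hw (mem_ball_self hr)
    · exact h
  have hmem : ∀ᶠ y in 𝓝[≠] (f z), y ∈ f '' U :=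
    nhdsWithin_le_nhds (hV.mem_nhds (mem_image_of_mem f hz))
  have htend : Tendsto g (𝓝[≠] (f z)) (𝓝[≠] z) := by
    refine tendsto_nhdsWithin_iff.2 ⟨?_, ?_⟩
    · have := hc.tendsto
      rw [hg hz] at this
      exact this.mono_left nhdsWithin_le_nhds
    · filter_upwards [hmem, eventually_mem_nhdsWithin]
      rintro _ ⟨w, hw, rfl⟩ hne h
      rw [hg hw] at h
      exact hne (by rw [mem_singleton_iff.1 h]; rfl)
  filter_upwards [hmem, htend.eventually key]
  rintro _ ⟨w, hw, rfl⟩ hd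
  rw [hg hw] at hd
  exact (hf.hasDerivAt_leftInverse_of_injOn hU hi hg hw hd).differentiableAt

theorem DifferentiableOn.deriv_leftInverse_mul {f g : ℂ → ℂ} {U : Set ℂ} (hU : IsOpen U)
    (hf : DifferentiableOn ℂ f U) (hi : InjOn f U) (hg : LeftInvOn g f U) {z : ℂ} (hz : z ∈ U) :
    _root_.deriv g (f z) * _root_.deriv f z = 1 := by
  have hV := hf.isOpen_image_of_injOn hU hi
  have hgd := ((hf.differentiableOn_leftInverse hU hi hg).differentiableAt
    (hV.mem_nhds (mem_image_of_mem f hz))).hasDerivAt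
  have hfd := (hf.differentiableAt (hU.mem_nhds hz)).hasDerivAt
  have h1 := hgd.comp z hfd
  have h2 : HasDerivAt (g ∘ f) 1 z := by
    refine (hasDerivAt_id z).congr_of_eventuallyEq ?_
    filter_upwards [hU.mem_nhds hz] with w hw using hg hw
  exact h1.unique h2

theorem DifferentiableOn.deriv_ne_zero_of_injOn {f : ℂ → ℂ} {U : Set ℂ} (hU : IsOpen U)
    (hf : DifferentiableOn ℂ f U) (hi : InjOn f U) {z : ℂ} (hz : z ∈ U) : _root_.deriv f z ≠ 0 :=
  right_ne_zero_of_mul_eq_one (hf.deriv_leftInverse_mul hU hi hi.leftInvOn_invFunOn hz)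

/-! ### Automorphisms of the unit disk -/

/-- The conformal automorphism of the unit disk that sends `a` to `0`. -/
noncomputable def diskMobius (a z : ℂ) : ℂ := (z - a) / (1 - conj a * z)

theorem one_sub_conj_mul_ne_zero {a z : ℂ} (ha : ‖a‖ < 1) (hz : ‖z‖ ≤ 1) : 1 - conj a * z ≠ 0 := by
  intro h
  have h1 : ‖conj a * z‖ = 1 := by rw [← sub_eq_zero.1 h]; simp
  rw [norm_mul, RCLike.norm_conj] at h1
  nlinarith [norm_nonneg a, norm_nonneg z]

theorem norm_sq_sub_norm_sq_mobius (a z : ℂ) :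
    ‖1 - conj a * z‖ ^ 2 - ‖z - a‖ ^ 2 = (1 - ‖a‖ ^ 2) * (1 - ‖z‖ ^ 2) := by
  simp only [← Complex.normSq_eq_norm_sq, Complex.normSq_apply]
  simp
  ring

theorem norm_diskMobius_lt_one {a z : ℂ} (ha : ‖a‖ < 1) (hz : ‖z‖ < 1) : ‖diskMobius a z‖ < 1 := by
  have h0 := one_sub_conj_mul_ne_zero ha hz.le
  rw [diskMobius, norm_div, div_lt_one (norm_pos_iff.2 h0)]
  refine lt_of_pow_lt_pow_left₀ 2 (norm_nonneg _) ?_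
  have h1 : 0 < 1 - ‖a‖ ^ 2 := by nlinarith [norm_nonneg a]
  have h2 : 0 < 1 - ‖z‖ ^ 2 := by nlinarith [norm_nonneg z]
  nlinarith [norm_sq_sub_norm_sq_mobius a z, mul_pos h1 h2]

theorem hasDerivAt_diskMobius {a z : ℂ} (h : 1 - conj a * z ≠ 0) :
    HasDerivAt (diskMobius a) ((1 - (‖a‖ : ℂ) ^ 2) / (1 - conj a * z) ^ 2) z := by
  have h1 : HasDerivAt (fun w => w - a) 1 z := (hasDerivAt_id z).sub_const a
  have h2 : HasDerivAt (fun w => 1 - conj a * w) (-(conj a)) z := by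
    simpa using ((hasDerivAt_id z).const_mul (conj a)).const_sub 1
  convert! h1.div h2 h using 1
  congr 1
  rw [← Complex.conj_mul']
  ring

theorem diskMobius_self (a : ℂ) : diskMobius a a = 0 := by simp [diskMobius]

theorem diskMobius_neg_diskMobius {a z : ℂ} (ha : ‖a‖ < 1) (hz : ‖z‖ < 1) :
    diskMobius (-a) (diskMobius a z) = z := by
  have h0 := one_sub_conj_mul_ne_zero ha hz.le
  have h1 : (1 : ℂ) - conj a * a ≠ 0 := one_sub_conj_mul_ne_zero ha ha.le
  have h0' : 1 - z * conj a ≠ 0 := by rwa [mul_comm]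
  have e1 : diskMobius a z - -a = z * (1 - conj a * a) / (1 - conj a * z) := by
    rw [diskMobius]; field_simp; ring
  have e2 : 1 - conj (-a) * diskMobius a z = (1 - conj a * a) / (1 - conj a * z) := by
    rw [diskMobius, map_neg]; field_simp; ring
  rw [diskMobius, e1, e2]
  field_simp

theorem differentiableOn_diskMobius {a : ℂ} (ha : ‖a‖ < 1) :
    DifferentiableOn ℂ (diskMobius a) (ball 0 1) := fun _ hz =>
  (hasDerivAt_diskMobius (one_sub_conj_mul_ne_zero ha
    (mem_ball_zero_iff.1 hz).le)).differentiableAt.differentiableWithinAt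

theorem mapsTo_diskMobius {a : ℂ} (ha : ‖a‖ < 1) : MapsTo (diskMobius a) (ball 0 1) (ball 0 1) :=
  fun _ hz => mem_ball_zero_iff.2 (norm_diskMobius_lt_one ha (mem_ball_zero_iff.1 hz))

theorem bijOn_diskMobius {a : ℂ} (ha : ‖a‖ < 1) : BijOn (diskMobius a) (ball 0 1) (ball 0 1) := by
  have ha' : ‖-a‖ < 1 := by simpa using ha
  refine InvOn.bijOn (f' := diskMobius (-a)) ⟨fun z hz => ?_, fun z hz => ?_⟩
    (mapsTo_diskMobius ha) (mapsTo_diskMobius ha')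
  · exact diskMobius_neg_diskMobius ha (mem_ball_zero_iff.1 hz)
  · simpa using diskMobius_neg_diskMobius ha' (mem_ball_zero_iff.1 hz)

/-! ### The Riemann mapping theorem -/

/-- This plays the role of Montel's theorem. Pointwise limits along an ultrafilter exist by
compactness of the closed disk, and the Schwarz lemma supplies a Lipschitz bound uniform in `i`,
which makes the convergence locally uniform. -/
theorem exists_tendstoLocallyUniformlyOn_ultrafilter {ι : Type*} (l : Ultrafilter ι)
    {F : ι → ℂ → ℂ} {U : Set ℂ} (hU : IsOpen U) (hF : ∀ i, DifferentiableOn ℂ (F i) U)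
    (hb : ∀ i, MapsTo (F i) U (closedBall 0 1)) :
    ∃ f : ℂ → ℂ, TendstoLocallyUniformlyOn F f l U := by
  have hlim : ∀ z ∈ U, ∃ w, Tendsto (fun i => F i z) l (𝓝 w) := by
    intro z hz
    obtain ⟨w, -, hw⟩ := (isCompact_closedBall (0 : ℂ) 1).ultrafilter_le_nhds
      (l.map fun i => F i z) (by
        rw [le_principal_iff]
        exact Filter.mem_map.2 (Filter.univ_mem' fun i => hb i hz))
    exact ⟨w, hw⟩
  choose! f hf using hlim
  refine ⟨f, Metric.tendstoLocallyUniformlyOn_iff.2 fun ε hε z hz => ?_⟩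
  obtain ⟨r, hr, hrU⟩ := Metric.isOpen_iff.1 hU z hz
  -- Values in the closed unit disk are at distance at most 2 from `F i z`, whence the constant `2 /
  -- r`.
  have hLip : ∀ i, ∀ x ∈ ball z r, dist (F i x) (F i z) ≤ 2 / r * dist x z := by
    intro i x hx
    refine Complex.dist_le_div_mul_dist_of_mapsTo_ball ((hF i).mono hrU) (fun y hy => ?_) hx
    have h1 := hb i (hrU hy)
    have h2 := hb i hz
    rw [mem_closedBall] at h1 h2 ⊢
    linarith [dist_triangle_right (F i y) (F i z) 0]
  have hLip' : ∀ x ∈ ball z r, dist (f x) (f z) ≤ 2 / r * dist x z := fun x hx =>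
    le_of_tendsto ((hf x (hrU hx)).dist (hf z hz)) (Eventually.of_forall fun i => hLip i x hx)
  have hδ : 0 < min r (ε * r / 8) := lt_min hr (by positivity)
  refine ⟨ball z (min r (ε * r / 8)), nhdsWithin_le_nhds (ball_mem_nhds _ hδ), ?_⟩
  filter_upwards [Metric.tendsto_nhds.1 (hf z hz) (ε / 4) (by positivity)] with i hi x hx
  have hxr : x ∈ ball z r := ball_subset_ball (min_le_left _ _) hx
  have hx' : 2 / r * dist x z ≤ ε / 4 := by
    have : dist x z ≤ ε * r / 8 := (mem_ball.1 hx).le.trans (min_le_right _ _)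
    calc 2 / r * dist x z ≤ 2 / r * (ε * r / 8) := by gcongr
      _ = ε / 4 := by field_simp; norm_num
  have h1 := hLip i x hxr
  have h2 := hLip' x hxr
  have h3 := dist_triangle4 (f x) (f z) (F i z) (F i x)
  rw [dist_comm (f z), dist_comm (F i z) (F i x)] at h3
  linarith

/-- Hurwitz's theorem. If `f a = f b`, a small circle about `b` that excludes `a` has `|f - f b| ≥ m
> 0`. For `F n` close to `f`, the quantitative open mapping theorem shows that `F n` takes every
value within `m / 4` of `F n b` in the closed disk, in particular `F n a`, against injectivity. -/
theorem TendstoLocallyUniformlyOn.injOn_of_deriv_ne_zero {ι : Type*} {l : Filter ι} [l.NeBot]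
    {F : ι → ℂ → ℂ} {f : ℂ → ℂ} {U : Set ℂ} (h : TendstoLocallyUniformlyOn F f l U)
    (hU : IsOpen U) (hc : IsPreconnected U) (hF : ∀ i, DifferentiableOn ℂ (F i) U)
    (hi : ∀ i, InjOn (F i) U) {z₀ : ℂ} (hz₀ : z₀ ∈ U) (h0 : _root_.deriv f z₀ ≠ 0) :
    InjOn f U := by
  have hfd : DifferentiableOn ℂ f U := h.differentiableOn (Eventually.of_forall hF) hU
  have hfa : AnalyticOnNhd ℂ f U := hfd.analyticOnNhd hU
  intro a ha b hb hab
  by_contra hne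
  have hev : ∀ᶠ z in 𝓝[≠] b, f z ≠ f b := by
    rcases (hfa b hb).eventually_eq_or_eventually_ne (analyticAt_const (v := f b)) with hh | hh
    · exfalso
      have h1 : EqOn f (fun _ => f b) U :=
        hfa.eqOn_of_preconnected_of_eventuallyEq analyticOnNhd_const hc hb hh
      have h2 : f =ᶠ[𝓝 z₀] fun _ => f b := h1.eventuallyEq_of_mem (hU.mem_nhds hz₀)
      exact h0 (by rw [h2.deriv_eq]; simp)
    · exact hh
  rw [eventually_nhdsWithin_iff] at hev
  obtain ⟨R, hR, hRU⟩ := Metric.eventually_nhds_iff_ball.1 (hev.and (hU.mem_nhds hb))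
  have hab' : 0 < dist a b := dist_pos.2 hne
  obtain ⟨r, hr, hrR⟩ := exists_between (lt_min hR hab')
  have hsub : closedBall b r ⊆ ball b R :=
    closedBall_subset_ball (hrR.trans_le (min_le_left _ _))
  have hra : a ∉ closedBall b r := fun h' =>
    absurd (mem_closedBall.1 h') (not_le.2 (hrR.trans_le (min_le_right _ _)))
  have hcU : closedBall b r ⊆ U := fun x hx => (hRU x (hsub hx)).2
  obtain ⟨p, hp, hpm⟩ := (isCompact_sphere b r).exists_isMinOn
    (NormedSpace.sphere_nonempty.2 hr.le) (f := fun z => ‖f z - f b‖)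
    (((hfd.continuousOn.mono (sphere_subset_closedBall.trans hcU)).sub continuousOn_const).norm)
  have hm : 0 < ‖f p - f b‖ := by
    refine norm_pos_iff.2 (sub_ne_zero.2 ((hRU p (hsub (sphere_subset_closedBall hp))).1 ?_))
    rintro rfl
    simp at hp
    exact hr.ne hp
  set m := ‖f p - f b‖
  have hK : IsCompact (insert a (closedBall b r)) := (isCompact_closedBall b r).insert a
  have hunif := (tendstoLocallyUniformlyOn_iff_forall_isCompact hU).1 h _
    (insert_subset ha hcU) hK
  obtain ⟨n, hn⟩ := (Metric.tendstoUniformlyOn_iff.1 hunif (m / 8) (by positivity)).exists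
  have hbK : b ∈ insert a (closedBall b r) := mem_insert_of_mem _ (mem_closedBall_self hr.le)
  have hnb := hn b hbK
  have hna := hn a (mem_insert _ _)
  have key := DiffContOnCl.ball_subset_image_closedBall (f := F n) (z₀ := b) (r := r) (ε := m / 2)
    (((hF n).mono hcU).diffContOnCl_ball Subset.rfl) hr (fun z hz => by
      have h1 := hn z (mem_insert_of_mem _ (sphere_subset_closedBall hz))
      have h2 : m ≤ dist (f z) (f b) := by rw [dist_eq_norm]; exact hpm hz
      have h3 := dist_triangle4 (f z) (F n z) (F n b) (f b)
      rw [dist_comm (F n b)] at h3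
      rw [← dist_eq_norm]
      linarith) (by
      have h1 : ∀ᶠ z in 𝓝[≠] b, F n z ≠ F n b := by
        filter_upwards [eventually_mem_nhdsWithin, nhdsWithin_le_nhds (hU.mem_nhds hb)]
          with z hz hzU hh using hz (hi n hzU hb hh)
      exact h1.frequently.filter_mono nhdsWithin_le_nhds)
  obtain ⟨z, hz, hzz⟩ := key (show F n a ∈ ball (F n b) (m / 2 / 2) by
    rw [mem_ball]
    have h3 := dist_triangle4 (F n a) (f a) (f b) (F n b)
    rw [hab] at hna
    rw [hab, dist_self, dist_comm (F n a) (f b)] at h3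
    linarith)
  exact hra (hi n (hcU hz) ha hzz ▸ hz)

/-- The difference quotient of `g` is that of `u = g²` divided by `g w + g z`, which tends to `2 * g
z ≠ 0`. -/
theorem ContinuousOn.hasDerivAt_of_sq_eq {g u : ℂ → ℂ} {U : Set ℂ} (hU : IsOpen U)
    (hg : ContinuousOn g U) (hu : DifferentiableOn ℂ u U) (h : ∀ z, g z ^ 2 = u z)
    (h0 : ∀ z ∈ U, u z ≠ 0) {z : ℂ} (hz : z ∈ U) :
    HasDerivAt g (deriv u z / (2 * g z)) z := by
  have hgz : g z ≠ 0 := fun h' => h0 z hz (by rw [← h, h']; simp)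
  have hc := hg.continuousAt (hU.mem_nhds hz)
  have hud := (hu.differentiableAt (hU.mem_nhds hz)).hasDerivAt
  rw [hasDerivAt_iff_tendsto_slope] at hud ⊢
  have h1 : Tendsto (fun w => g w + g z) (𝓝[≠] z) (𝓝 (2 * g z)) := by
    rw [two_mul]
    exact (hc.tendsto.mono_left nhdsWithin_le_nhds).add_const _
  have h2 : 2 * g z ≠ 0 := mul_ne_zero two_ne_zero hgz
  refine (hud.div h1 h2).congr' ?_
  filter_upwards [h1.eventually_ne h2] with w hw
  simp only [Pi.div_apply, slope_def_field, ← h]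
  rw [sq_sub_sq, div_right_comm, mul_div_cancel_left₀ _ hw]

theorem exists_mapsTo_ball_injOn {U : Set ℂ} (hU : IsOpen U) (hUc : IsSimplyConnected U)
    (hU1 : U ≠ univ) :
    ∃ f : ℂ → ℂ, DifferentiableOn ℂ f U ∧ MapsTo f U (ball 0 1) ∧ InjOn f U := by
  obtain ⟨a, ha⟩ := (ne_univ_iff_exists_notMem U).1 hU1
  obtain ⟨x, hx⟩ := hUc.nonempty
  have hud : DifferentiableOn ℂ (fun z => z - a) U := differentiableOn_id.sub_const a
  have hu0 : ∀ z ∈ U, z - a ≠ 0 := fun z hz h => ha (sub_eq_zero.1 h ▸ hz)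
  obtain ⟨g, hgc, hg⟩ := Complex.exists_continuousOn_pow_eq hUc hU hud.continuousOn
    (fun ⟨z, hz, h⟩ => hu0 z hz h) two_ne_zero
  have hgd : DifferentiableOn ℂ g U := fun z hz =>
    (hgc.hasDerivAt_of_sq_eq hU hud hg hu0 hz).differentiableAt.differentiableWithinAt
  have hsq : ∀ z w, g z ^ 2 = g w ^ 2 → z = w := fun z w h => by
    rw [hg, hg] at h
    exact sub_left_injective h
  have hgi : InjOn g U := fun z _ w _ h => hsq z w (by rw [h])
  obtain ⟨r, hr, hrU⟩ := Metric.isOpen_iff.1 (hgd.isOpen_image_of_injOn hU hgi) _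
    (mem_image_of_mem g hx)
  -- The image of a square root never contains both `v` and `-v`: a point `-g z` of the disk about
  -- `g x` would equal some `g w`, forcing `w = z` and `g z = 0`. So the image omits a disk about
  -- `-g x`, and an inversion makes it bounded.
  have hfar : ∀ z ∈ U, r ≤ ‖g z + g x‖ := by
    intro z hz
    by_contra! hlt
    obtain ⟨w, hw, hwz⟩ := hrU (show -g z ∈ ball (g x) r by
      rw [mem_ball, dist_eq_norm, ← norm_neg]
      simpa [add_comm] using hlt)
    obtain rfl := hsq w z (by rw [hwz, neg_sq])
    refine hu0 w hw ?_
    rw [← hg, self_eq_neg.1 hwz]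
    simp
  have hne : ∀ z ∈ U, g z + g x ≠ 0 := fun z hz => norm_pos_iff.1 (hr.trans_le (hfar z hz))
  refine ⟨fun z => (r / 2 : ℝ) / (g z + g x),
    (differentiableOn_const _).div (hgd.add_const _) hne, fun z hz => ?_, fun z hz w hw h => ?_⟩
  · rw [mem_ball_zero_iff, norm_div, div_lt_one (norm_pos_iff.2 (hne z hz)), Complex.norm_real,
      Real.norm_of_nonneg (by positivity)]
    linarith [hfar z hz]
  · have hr' : ((r / 2 : ℝ) : ℂ) ≠ 0 := by exact_mod_cast (half_pos hr).ne'
    have h1 := inv_injective (mul_left_cancel₀ hr' (by simpa only [div_eq_mul_inv] using h))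
    exact hgi hz hw (add_left_injective _ h1)

/-- Koebe's square root trick: move the omitted value `a` to 0, take a square root, and move the
image of `z₀` back to 0. With `t = √|a|` the derivative is multiplied in modulus by `(1 + t²) / (2t)
> 1`. -/
theorem exists_injOn_norm_deriv_gt {U : Set ℂ} (hU : IsOpen U) (hUc : IsSimplyConnected U)
    {f : ℂ → ℂ} (hf : DifferentiableOn ℂ f U) (hm : MapsTo f U (ball 0 1)) (hi : InjOn f U)
    {z₀ : ℂ} (hz₀ : z₀ ∈ U) (hf0 : f z₀ = 0) {a : ℂ} (ha : a ∈ ball (0 : ℂ) 1)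
    (haU : a ∉ f '' U) :
    ∃ F : ℂ → ℂ, DifferentiableOn ℂ F U ∧ MapsTo F U (ball 0 1) ∧ InjOn F U ∧ F z₀ = 0 ∧
      ‖deriv f z₀‖ < ‖deriv F z₀‖ := by
  have ha1 : ‖a‖ < 1 := mem_ball_zero_iff.1 ha
  have hud : DifferentiableOn ℂ (diskMobius a ∘ f) U := (differentiableOn_diskMobius ha1).comp hf hm
  have hu0 : ∀ z ∈ U, (diskMobius a ∘ f) z ≠ 0 := by
    intro z hz h
    refine haU ⟨z, hz, (bijOn_diskMobius ha1).injOn (hm hz) ha ?_⟩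
    rw [diskMobius_self]
    exact h
  have humaps : MapsTo (diskMobius a ∘ f) U (ball 0 1) := (mapsTo_diskMobius ha1).comp hm
  obtain ⟨g, hgc, hg⟩ := Complex.exists_continuousOn_pow_eq hUc hU hud.continuousOn
    (fun ⟨z, hz, h⟩ => hu0 z hz h) two_ne_zero
  have hgd := fun {z : ℂ} (hz : z ∈ U) => hgc.hasDerivAt_of_sq_eq hU hud hg hu0 hz
  have hgm : MapsTo g U (ball 0 1) := by
    intro z hz
    have h1 := mem_ball_zero_iff.1 (humaps hz)
    rw [← hg, norm_pow] at h1
    rw [mem_ball_zero_iff]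
    nlinarith [norm_nonneg (g z)]
  have hgi : InjOn g U := by
    intro x hx y hy hxy
    refine hi hx hy ((bijOn_diskMobius ha1).injOn (hm hx) (hm hy) ?_)
    have := hg x
    rw [hxy, hg y] at this
    exact this.symm
  have hb1 : ‖g z₀‖ < 1 := mem_ball_zero_iff.1 (hgm hz₀)
  refine ⟨diskMobius (g z₀) ∘ g, (differentiableOn_diskMobius hb1).comp
    (fun z hz => (hgd hz).differentiableAt.differentiableWithinAt) hgm,
    (mapsTo_diskMobius hb1).comp hgm, (bijOn_diskMobius hb1).injOn.comp hgi hgm,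
    diskMobius_self _, ?_⟩
  have hga : ‖g z₀‖ ^ 2 = ‖a‖ := by
    rw [← norm_pow, hg]
    simp [diskMobius, hf0]
  have hg0 : 0 < ‖g z₀‖ := by
    rw [norm_pos_iff]
    intro h
    exact hu0 z₀ hz₀ (by rw [← hg, h]; simp)
  have hfd := (hf.differentiableAt (hU.mem_nhds hz₀)).hasDerivAt
  have hderu : deriv (diskMobius a ∘ f) z₀ = (1 - (‖a‖ : ℂ) ^ 2) * deriv f z₀ := by
    have h1 := (hasDerivAt_diskMobius (a := a) (z := f z₀) (by simp [hf0])).comp z₀ hfd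
    rw [h1.deriv, hf0]
    simp
  have hderF := ((hasDerivAt_diskMobius (one_sub_conj_mul_ne_zero hb1 hb1.le)).comp z₀
    (hgd hz₀)).deriv
  have hf' : 0 < ‖deriv f z₀‖ := norm_pos_iff.2 (hf.deriv_ne_zero_of_injOn hU hi hz₀)
  have hn1 : ∀ t : ℝ, 0 ≤ t → t < 1 → ‖(1 - (t : ℂ) ^ 2)‖ = 1 - t ^ 2 := by
    intro t ht ht1
    rw [show (1 - (t : ℂ) ^ 2) = ((1 - t ^ 2 : ℝ) : ℂ) by push_cast; ring, Complex.norm_real,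
      Real.norm_of_nonneg (by nlinarith)]
  rw [hderF, hderu, Complex.conj_mul', norm_mul, norm_div, norm_div, norm_mul, norm_pow,
    hn1 _ (norm_nonneg _) ha1, hn1 _ (norm_nonneg _) hb1, norm_mul, ← hga]
  set t := ‖g z₀‖
  have ht : 0 < 1 - t ^ 2 := by nlinarith
  have : (1 - t ^ 2) / (1 - t ^ 2) ^ 2 * ((1 - (t ^ 2) ^ 2) * ‖deriv f z₀‖ / (‖(2 : ℂ)‖ * t))
      = (1 + t ^ 2) / (2 * t) * ‖deriv f z₀‖ := by
    rw [Complex.norm_ofNat]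
    field_simp
    ring
  rw [this]
  refine lt_mul_of_one_lt_left hf' ?_
  rw [one_lt_div (by positivity)]
  nlinarith [sq_pos_of_pos (sub_pos.2 hb1)]

/-- Maximize `|f'(z₀)|` among injective maps into the disk with `f z₀ = 0`. The maximum is attained
by a limit of a maximizing sequence, and a maximizer omitting a value of the disk could be improved.
-/
theorem exists_bijOn_ball_of_isSimplyConnected {U : Set ℂ} (hU : IsOpen U)
    (hUc : IsSimplyConnected U) (hU1 : U ≠ univ) :
    ∃ f : ℂ → ℂ, DifferentiableOn ℂ f U ∧ BijOn f U (ball 0 1) := by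
  obtain ⟨z₀, hz₀⟩ := hUc.nonempty
  have hpre : IsPreconnected U := hUc.isPathConnected.isConnected.isPreconnected
  let S : Set ℝ := {s | ∃ f : ℂ → ℂ, (DifferentiableOn ℂ f U ∧ MapsTo f U (ball 0 1) ∧ InjOn f U ∧
    f z₀ = 0) ∧ ‖deriv f z₀‖ = s}
  obtain ⟨r, hr, hrU⟩ := Metric.isOpen_iff.1 hU z₀ hz₀
  have hbdd : BddAbove S := by
    refine ⟨1 / r, ?_⟩
    rintro _ ⟨f, ⟨hf, hm, -, h0⟩, rfl⟩
    refine Complex.norm_deriv_le_div_of_mapsTo_ball (hf.mono hrU) (fun z hz => ?_) hr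
    rw [h0]
    exact ball_subset_closedBall (hm (hrU hz))
  obtain ⟨f₁, ⟨hf₁, hm₁, hi₁, h₁⟩, hd₁⟩ : ∃ f : ℂ → ℂ, (DifferentiableOn ℂ f U ∧
      MapsTo f U (ball 0 1) ∧ InjOn f U ∧ f z₀ = 0) ∧ deriv f z₀ ≠ 0 := by
    obtain ⟨f, hfd, hm, hi⟩ := exists_mapsTo_ball_injOn hU hUc hU1
    have hb := mem_ball_zero_iff.1 (hm hz₀)
    have hd' := (differentiableOn_diskMobius hb).comp hfd hm
    have hi' := (bijOn_diskMobius hb).injOn.comp hi hm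
    exact ⟨diskMobius (f z₀) ∘ f, ⟨hd', (mapsTo_diskMobius hb).comp hm, hi', diskMobius_self _⟩,
      hd'.deriv_ne_zero_of_injOn hU hi' hz₀⟩
  have hne : S.Nonempty := ⟨_, f₁, ⟨hf₁, hm₁, hi₁, h₁⟩, rfl⟩
  have hspos : 0 < sSup S :=
    (norm_pos_iff.2 hd₁).trans_le (le_csSup hbdd ⟨f₁, ⟨hf₁, hm₁, hi₁, h₁⟩, rfl⟩)
  obtain ⟨u, -, hu, huS⟩ := exists_seq_tendsto_sSup hne hbdd
  choose F hF hFu using huS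
  let l : Ultrafilter ℕ := hyperfilter ℕ
  have hl : (l : Filter ℕ) ≤ atTop := Nat.hyperfilter_le_atTop
  obtain ⟨f, hf⟩ := exists_tendstoLocallyUniformlyOn_ultrafilter l hU (fun n => (hF n).1)
    (fun n => (hF n).2.1.mono_right ball_subset_closedBall)
  have hfd : DifferentiableOn ℂ f U :=
    hf.differentiableOn (Eventually.of_forall fun n => (hF n).1) hU
  have hnorm : ‖deriv f z₀‖ = sSup S := by
    have h1 := ((hf.deriv (Eventually.of_forall fun n => (hF n).1) hU).tendsto_at hz₀).norm
    have h2 : Tendsto (fun n => ‖deriv (F n) z₀‖) l (𝓝 (sSup S)) := by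
      simp_rw [hFu]
      exact hu.mono_left hl
    exact tendsto_nhds_unique h1 h2
  have hder : deriv f z₀ ≠ 0 := by
    rw [← norm_pos_iff, hnorm]
    exact hspos
  have hfi : InjOn f U := hf.injOn_of_deriv_ne_zero hU hpre (fun n => (hF n).1)
    (fun n => (hF n).2.2.1) hz₀ hder
  have hf0 : f z₀ = 0 := by
    have h1 := hf.tendsto_at hz₀
    simp_rw [fun n => (hF n).2.2.2] at h1
    exact tendsto_nhds_unique h1 tendsto_const_nhds
  have hfm : MapsTo f U (ball 0 1) := by
    have h1 : f '' U ⊆ closedBall 0 1 := by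
      rintro _ ⟨z, hz, rfl⟩
      exact isClosed_closedBall.mem_of_tendsto (hf.tendsto_at hz)
        (Eventually.of_forall fun n => ball_subset_closedBall ((hF n).2.1 hz))
    -- The limit has values only in the closed disk a priori; its image is open, hence lies in the
    -- interior.
    have h2 := interior_maximal h1 (hfd.isOpen_image_of_injOn hU hfi)
    rw [interior_closedBall _ one_ne_zero] at h2
    exact fun z hz => h2 (mem_image_of_mem f hz)
  refine ⟨f, hfd, hfm, hfi, fun a ha => ?_⟩
  by_contra haU
  obtain ⟨G, hG, hGm, hGi, hG0, hGd⟩ := exists_injOn_norm_deriv_gt hU hUc hfd hfm hfi hz₀ hf0 ha haU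
  rw [hnorm] at hGd
  exact absurd (le_csSup hbdd ⟨G, ⟨hG, hGm, hGi, hG0⟩, rfl⟩) (not_le.2 hGd)

/-! ### Schwarz-Pick inequalities -/

theorem norm_deriv_mul_le_of_mapsTo_ball {F : ℂ → ℂ} (hF : DifferentiableOn ℂ F (ball 0 1))
    (hm : MapsTo F (ball 0 1) (ball 0 1)) {w : ℂ} (hw : w ∈ ball (0 : ℂ) 1) :
    ‖deriv F w‖ * (1 - ‖w‖ ^ 2) ≤ 1 - ‖F w‖ ^ 2 := by
  have hw1 := mem_ball_zero_iff.1 hw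
  have hp1 := mem_ball_zero_iff.1 (hm hw)
  have hw' : ‖-w‖ < 1 := by simpa using hw1
  have hpos : 0 < 1 - ‖F w‖ ^ 2 := by nlinarith [norm_nonneg (F w)]
  have hpos' : 0 < 1 - ‖w‖ ^ 2 := by nlinarith [norm_nonneg w]
  have h0 : diskMobius (-w) 0 = w := by simp [diskMobius]
  have hd : DifferentiableOn ℂ (diskMobius (F w) ∘ F ∘ diskMobius (-w)) (ball 0 1) :=
    (differentiableOn_diskMobius hp1).comp
      (hF.comp (differentiableOn_diskMobius hw') (mapsTo_diskMobius hw'))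
      (hm.comp (mapsTo_diskMobius hw'))
  have hmaps : MapsTo (diskMobius (F w) ∘ F ∘ diskMobius (-w)) (ball 0 1) (ball 0 1) :=
    (mapsTo_diskMobius hp1).comp (hm.comp (mapsTo_diskMobius hw'))
  have hT0 : (diskMobius (F w) ∘ F ∘ diskMobius (-w)) 0 = 0 := by
    simp only [Function.comp_apply, h0, diskMobius_self]
  have key := Complex.norm_deriv_le_one_of_mapsTo_ball hd (by
    rw [hT0]
    exact hmaps.mono_right ball_subset_closedBall) one_pos
  have h1 : HasDerivAt (diskMobius (-w)) (1 - (‖w‖ : ℂ) ^ 2) 0 := by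
    simpa using hasDerivAt_diskMobius (a := -w) (z := 0) (by simp)
  have h2 : HasDerivAt F (deriv F w) (diskMobius (-w) 0) := by
    rw [h0]
    exact (hF.differentiableAt (isOpen_ball.mem_nhds hw)).hasDerivAt
  have h3 : HasDerivAt (diskMobius (F w)) (1 - (‖F w‖ : ℂ) ^ 2)⁻¹
      ((F ∘ diskMobius (-w)) 0) := by
    have := hasDerivAt_diskMobius (one_sub_conj_mul_ne_zero hp1 hp1.le)
    rw [Function.comp_apply, h0]
    convert this using 1
    rw [Complex.conj_mul']
    have : (1 - (‖F w‖ : ℂ) ^ 2) ≠ 0 := by exact_mod_cast hpos.ne'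
    field_simp
  have h4 := (h3.comp 0 (h2.comp 0 h1)).deriv
  have hn : ∀ t : ℝ, 0 < 1 - t ^ 2 → ‖(1 - (t : ℂ) ^ 2)‖ = 1 - t ^ 2 := by
    intro t ht
    rw [show (1 - (t : ℂ) ^ 2) = ((1 - t ^ 2 : ℝ) : ℂ) by push_cast; ring, Complex.norm_real,
      Real.norm_of_nonneg ht.le]
  rw [h4, norm_mul, norm_mul, norm_inv, hn _ hpos, hn _ hpos', inv_mul_le_iff₀ hpos, mul_one] at key
  exact key

/-- Schwarz-Pick for `F / R` bounds the left side by `R - |F w|² / R`, which is at most `R (1 - |F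
w|²)` as `R ≤ 1`. For `M < 1` let `R` decrease to `M`, since `F / R` must map into the open disk and
`M` may be 0; for `M ≥ 1` take `R = 1`. -/
theorem norm_deriv_mul_le_mul_of_norm_le {F : ℂ → ℂ} (hF : DifferentiableOn ℂ F (ball 0 1))
    {M : ℝ} (hM : ∀ ζ ∈ ball (0 : ℂ) 1, ‖F ζ‖ ≤ M) (h1 : ∀ ζ ∈ ball (0 : ℂ) 1, ‖F ζ‖ < 1)
    {w : ℂ} (hw : w ∈ ball (0 : ℂ) 1) :
    ‖deriv F w‖ * (1 - ‖w‖ ^ 2) ≤ M * (1 - ‖F w‖ ^ 2) := by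
  have hM0 : 0 ≤ M := (norm_nonneg _).trans (hM w hw)
  have hdef : 0 < 1 - ‖F w‖ ^ 2 := by nlinarith [norm_nonneg (F w), h1 w hw]
  have main : ∀ R : ℝ, 0 < R → R ≤ 1 → (∀ ζ ∈ ball (0 : ℂ) 1, ‖F ζ‖ < R) →
      ‖deriv F w‖ * (1 - ‖w‖ ^ 2) ≤ R * (1 - ‖F w‖ ^ 2) := by
    intro R hR hR1 hlt
    have hm : MapsTo (fun ζ => F ζ / (R : ℂ)) (ball 0 1) (ball 0 1) := fun ζ hζ => by
      rw [mem_ball_zero_iff, norm_div, Complex.norm_real, Real.norm_of_nonneg hR.le,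
        div_lt_one hR]
      exact hlt ζ hζ
    have key := norm_deriv_mul_le_of_mapsTo_ball (hF.div_const _) hm hw
    rw [deriv_div_const, norm_div, norm_div, Complex.norm_real, Real.norm_of_nonneg hR.le] at key
    have e1 : ‖deriv F w‖ / R * (1 - ‖w‖ ^ 2) = ‖deriv F w‖ * (1 - ‖w‖ ^ 2) / R := by ring
    rw [e1, div_le_iff₀ hR] at key
    refine key.trans ?_
    have e2 : (1 - (‖F w‖ / R) ^ 2) * R = R - ‖F w‖ ^ 2 / R := by field_simp
    rw [e2]
    have e3 : ‖F w‖ ^ 2 * R ≤ ‖F w‖ ^ 2 / R := by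
      rw [le_div_iff₀ hR, mul_assoc]
      exact mul_le_of_le_one_right (sq_nonneg _) (by nlinarith)
    linarith
  rcases le_or_gt 1 M with h | h
  · exact (main 1 one_pos le_rfl h1).trans (by gcongr)
  · rw [← div_le_iff₀ hdef]
    refine le_of_forall_gt_imp_ge_of_dense fun R hR => ?_
    rcases le_or_gt R 1 with h' | h'
    · rw [div_le_iff₀ hdef]
      exact main R (hM0.trans_lt hR) h' fun ζ hζ => (hM ζ hζ).trans_lt hR
    · rw [div_le_iff₀ hdef]
      exact (main 1 one_pos le_rfl h1).trans (by gcongr)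

/-! ### Jacobian and pre-Schwarzian in terms of `h'` and `g'` -/

theorem ContinuousLinearMap.det_eq_of_apply {L : ℂ →L[ℝ] ℂ} {a b : ℂ}
    (h : ∀ v, L v = a * v + conj (b * v)) : L.det = ‖a‖ ^ 2 - ‖b‖ ^ 2 := by
  rw [ContinuousLinearMap.det, ← LinearMap.det_toMatrix Complex.basisOneI, Matrix.det_fin_two]
  simp only [LinearMap.toMatrix_apply, Complex.coe_basisOneI, Complex.coe_basisOneI_repr,
    ContinuousLinearMap.coe_coe, h, ← Complex.normSq_eq_norm_sq, Complex.normSq_apply]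
  simp
  ring

section Formula

variable {f h g : ℂ → ℂ} {D : Set ℂ}

theorem hasFDerivAt_add_conj {z a b : ℂ} (hh : HasDerivAt h a z) (hg : HasDerivAt g b z) :
    ∃ L : ℂ →L[ℝ] ℂ, HasFDerivAt (fun w => h w + conj (g w)) L z ∧
      ∀ v, L v = a * v + conj (b * v) := by
  have h1 := hh.hasFDerivAt.restrictScalars ℝ
  have h2 := (Complex.conjCLE : ℂ →L[ℝ] ℂ).hasFDerivAt.comp z (hg.hasFDerivAt.restrictScalars ℝ)
  refine ⟨_, h1.add h2, fun v => ?_⟩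
  simp [mul_comm]

theorem jacobian_eq_of_eventuallyEq {z : ℂ} (hh : DifferentiableAt ℂ h z)
    (hg : DifferentiableAt ℂ g z) (hf : f =ᶠ[𝓝 z] fun w => h w + conj (g w)) :
    jacobian f z = ‖deriv h z‖ ^ 2 - ‖deriv g z‖ ^ 2 := by
  obtain ⟨L, hL, hv⟩ := hasFDerivAt_add_conj hh.hasDerivAt hg.hasDerivAt
  rw [jacobian, hf.fderiv_eq, hL.fderiv]
  exact ContinuousLinearMap.det_eq_of_apply hv

theorem jacobian_eq (hD : IsOpen D) (hh : DifferentiableOn ℂ h D) (hg : DifferentiableOn ℂ g D)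
    (hf : ∀ z ∈ D, f z = h z + conj (g z)) {z : ℂ} (hz : z ∈ D) :
    jacobian f z = ‖deriv h z‖ ^ 2 - ‖deriv g z‖ ^ 2 :=
  jacobian_eq_of_eventuallyEq (hh.differentiableAt (hD.mem_nhds hz))
    (hg.differentiableAt (hD.mem_nhds hz)) (by filter_upwards [hD.mem_nhds hz] with w hw using hf w hw)

theorem hasFDerivAt_norm_sq_of_hasDerivAt {u : ℂ → ℂ} {z a : ℂ} (hu : HasDerivAt u a z) :
    ∃ L : ℂ →L[ℝ] ℝ, HasFDerivAt (fun w => ‖u w‖ ^ 2) L z ∧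
      ∀ v, L v = 2 * (conj (u z) * a * v).re := by
  refine ⟨_, (hu.hasFDerivAt.restrictScalars ℝ).norm_sq, fun v => ?_⟩
  simp [Complex.inner]
  ring

theorem preSchwarzian_eq (hD : IsOpen D) (hh : DifferentiableOn ℂ h D)
    (hg : DifferentiableOn ℂ g D) (hf : ∀ z ∈ D, f z = h z + conj (g z)) {z : ℂ} (hz : z ∈ D)
    (hpos : 0 < ‖deriv h z‖ ^ 2 - ‖deriv g z‖ ^ 2) :
    preSchwarzian f z = (deriv (deriv h) z * conj (deriv h z) -
      deriv (deriv g) z * conj (deriv g z)) /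
        (deriv h z * conj (deriv h z) - deriv g z * conj (deriv g z)) := by
  have hh2 := ((hh.deriv hD).differentiableAt (hD.mem_nhds hz)).hasDerivAt
  have hg2 := ((hg.deriv hD).differentiableAt (hD.mem_nhds hz)).hasDerivAt
  obtain ⟨L₁, hL₁, hv₁⟩ := hasFDerivAt_norm_sq_of_hasDerivAt hh2
  obtain ⟨L₂, hL₂, hv₂⟩ := hasFDerivAt_norm_sq_of_hasDerivAt hg2
  have hev : (fun w => ((Real.log (jacobian f w) : ℝ) : ℂ)) =ᶠ[𝓝 z]
      fun w => ((Real.log (‖deriv h w‖ ^ 2 - ‖deriv g w‖ ^ 2) : ℝ) : ℂ) := by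
    filter_upwards [hD.mem_nhds hz] with w hw
    rw [jacobian_eq hD hh hg hf hw]
  have hlog := Complex.ofRealCLM.hasFDerivAt.comp z ((hL₁.fun_sub hL₂).log hpos.ne')
  have hJ : deriv h z * conj (deriv h z) - deriv g z * conj (deriv g z) =
      ((‖deriv h z‖ ^ 2 - ‖deriv g z‖ ^ 2 : ℝ) : ℂ) := by
    rw [Complex.mul_conj', Complex.mul_conj']
    push_cast
    ring
  rw [preSchwarzian, wirtingerDeriv, hev.fderiv_eq, hJ]
  erw [hlog.fderiv]
  have hJ0 : ((‖deriv h z‖ ^ 2 - ‖deriv g z‖ ^ 2 : ℝ) : ℂ) ≠ 0 := by exact_mod_cast hpos.ne'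
  set J := ‖deriv h z‖ ^ 2 - ‖deriv g z‖ ^ 2
  rw [eq_div_iff hJ0]
  have hJr : J ≠ 0 := hpos.ne'
  simp only [ContinuousLinearMap.comp_apply, smul_apply,
    sub_apply, hv₁, hv₂, Complex.ofRealCLM_apply, smul_eq_mul]
  push_cast
  field_simp
  apply Complex.ext
  · simp
  · simp; ring

theorem IsSensePreservingHarmonic.norm_sq_sub_pos (H : IsSensePreservingHarmonic f h g D)
    (hD : IsOpen D) {z : ℂ} (hz : z ∈ D) : 0 < ‖deriv h z‖ ^ 2 - ‖deriv g z‖ ^ 2 := by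
  rw [← jacobian_eq hD H.analytic_h H.analytic_g H.decomposition hz]
  exact H.jacobian_pos z hz

end Formula

/-! ### The pointwise difference of pre-Schwarzians -/

theorem norm_conj_add_mul_conj_le {ε a b : ℂ} (hε : ‖ε‖ ≤ 1) (hab : ‖b‖ ≤ ‖a‖) :
    ‖conj b + ε * conj a‖ ≤ ‖a + ε * b‖ := by
  have h : ‖a + ε * b‖ ^ 2 - ‖conj b + ε * conj a‖ ^ 2 =
      (1 - ‖ε‖ ^ 2) * (‖a‖ ^ 2 - ‖b‖ ^ 2) := by
    simp only [← Complex.normSq_eq_norm_sq, Complex.normSq_apply]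
    simp
    ring
  refine le_of_sq_le_sq ?_ (norm_nonneg _)
  have h1 : 0 ≤ 1 - ‖ε‖ ^ 2 := by nlinarith [norm_nonneg ε]
  have h2 : 0 ≤ ‖a‖ ^ 2 - ‖b‖ ^ 2 := by nlinarith [norm_nonneg b]
  nlinarith [mul_nonneg h1 h2]

section Formula

variable {f h g : ℂ → ℂ} {D : Set ℂ}

namespace IsSensePreservingHarmonic

theorem norm_deriv_lt (H : IsSensePreservingHarmonic f h g D) (hD : IsOpen D) {z : ℂ}
    (hz : z ∈ D) : ‖deriv g z‖ < ‖deriv h z‖ :=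
  lt_of_pow_lt_pow_left₀ 2 (norm_nonneg _) (sub_pos.1 (H.norm_sq_sub_pos hD hz))

theorem deriv_ne_zero (H : IsSensePreservingHarmonic f h g D) (hD : IsOpen D) {z : ℂ}
    (hz : z ∈ D) : deriv h z ≠ 0 :=
  norm_pos_iff.1 ((norm_nonneg _).trans_lt (H.norm_deriv_lt hD hz))

theorem norm_dilatation_lt_one (H : IsSensePreservingHarmonic f h g D) (hD : IsOpen D) {z : ℂ}
    (hz : z ∈ D) : ‖dilatation h g z‖ < 1 := by
  rw [dilatation, norm_div, div_lt_one (norm_pos_iff.2 (H.deriv_ne_zero hD hz))]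
  exact H.norm_deriv_lt hD hz

theorem norm_dilatation_le_supDilatation (H : IsSensePreservingHarmonic f h g D) (hD : IsOpen D)
    {z : ℂ} (hz : z ∈ D) : ‖dilatation h g z‖ ≤ supDilatation h g D := by
  refine le_csSup ⟨1, ?_⟩ (mem_image_of_mem _ hz)
  rintro _ ⟨w, hw, rfl⟩
  exact (H.norm_dilatation_lt_one hD hw).le

theorem hasDerivAt_dilatation (H : IsSensePreservingHarmonic f h g D) (hD : IsOpen D) {z : ℂ}
    (hz : z ∈ D) : HasDerivAt (dilatation h g)
      ((deriv (deriv g) z * deriv h z - deriv g z * deriv (deriv h) z) / deriv h z ^ 2) z :=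
  ((H.analytic_g.deriv hD).differentiableAt (hD.mem_nhds hz)).hasDerivAt.div
    ((H.analytic_h.deriv hD).differentiableAt (hD.mem_nhds hz)).hasDerivAt (H.deriv_ne_zero hD hz)

theorem add_mul_deriv_ne_zero (H : IsSensePreservingHarmonic f h g D) (hD : IsOpen D) {ε z : ℂ}
    (hε : ‖ε‖ ≤ 1) (hz : z ∈ D) : deriv h z + ε * deriv g z ≠ 0 := by
  intro h0
  have h1 : ‖deriv h z‖ = ‖ε‖ * ‖deriv g z‖ := by
    rw [← norm_mul, ← norm_neg (ε * _), ← eq_neg_of_add_eq_zero_left h0]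
  have h2 := H.norm_deriv_lt hD hz
  nlinarith [norm_nonneg (deriv g z)]

theorem preSchwarzian_add_mul (H : IsSensePreservingHarmonic f h g D) (hD : IsOpen D) {ε z : ℂ}
    (hε : ‖ε‖ ≤ 1) (hz : z ∈ D) :
    preSchwarzian (fun w => h w + ε * g w) z =
      (deriv (deriv h) z + ε * deriv (deriv g) z) / (deriv h z + ε * deriv g z) := by
  have hd : ∀ w ∈ D, deriv (fun w => h w + ε * g w) w = deriv h w + ε * deriv g w := fun w hw =>
    ((H.analytic_h.differentiableAt (hD.mem_nhds hw)).hasDerivAt.add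
      ((H.analytic_g.differentiableAt (hD.mem_nhds hw)).hasDerivAt.const_mul ε)).deriv
  have hdd : deriv (deriv (fun w => h w + ε * g w)) z =
      deriv (deriv h) z + ε * deriv (deriv g) z := by
    have hev : deriv (fun w => h w + ε * g w) =ᶠ[𝓝 z] fun w => deriv h w + ε * deriv g w := by
      filter_upwards [hD.mem_nhds hz] with w hw using hd w hw
    rw [hev.deriv_eq]
    exact ((((H.analytic_h.deriv hD).differentiableAt (hD.mem_nhds hz)).hasDerivAt).add
      (((H.analytic_g.deriv hD).differentiableAt (hD.mem_nhds hz)).hasDerivAt.const_mul ε)).deriv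
  have hne := H.add_mul_deriv_ne_zero hD hε hz
  have hne' : conj (deriv h z + ε * deriv g z) ≠ 0 := (map_ne_zero _).2 hne
  -- An analytic function is a harmonic mapping with vanishing co-analytic part, so the general
  -- formula applies.
  have key := preSchwarzian_eq (f := fun w => h w + ε * g w) (h := fun w => h w + ε * g w)
    (g := fun _ => 0) hD (H.analytic_h.add (H.analytic_g.const_mul ε)) (differentiableOn_const 0)
    (by simp) hz (by
      rw [hd z hz]
      simpa using pow_pos (norm_pos_iff.2 hne) 2)
  rw [key, hdd, hd z hz]
  simp only [deriv_const, deriv_const', zero_mul, sub_zero]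
  rw [mul_div_mul_right _ _ hne']

theorem norm_preSchwarzian_sub (H : IsSensePreservingHarmonic f h g D) (hD : IsOpen D) {ε z : ℂ}
    (hε : ‖ε‖ ≤ 1) (hz : z ∈ D) :
    ‖preSchwarzian (fun w => h w + ε * g w) z - preSchwarzian f z‖ =
      ‖deriv (dilatation h g) z‖ / (1 - ‖dilatation h g z‖ ^ 2) *
        (‖conj (deriv g z) + ε * conj (deriv h z)‖ / ‖deriv h z + ε * deriv g z‖) := by
  have hpos := H.norm_sq_sub_pos hD hz
  have hne := H.add_mul_deriv_ne_zero hD hε hz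
  have ha := H.deriv_ne_zero hD hz
  rw [H.preSchwarzian_add_mul hD hε hz,
    preSchwarzian_eq hD H.analytic_h H.analytic_g H.decomposition hz hpos,
    (H.hasDerivAt_dilatation hD hz).deriv, dilatation]
  set a := deriv h z
  set b := deriv g z
  set a' := deriv (deriv h) z
  set b' := deriv (deriv g) z
  have hJ : a * conj a - b * conj b = ((‖a‖ ^ 2 - ‖b‖ ^ 2 : ℝ) : ℂ) := by
    rw [Complex.mul_conj', Complex.mul_conj']
    push_cast
    ring
  have hJ0 : a * conj a - b * conj b ≠ 0 := by
    rw [hJ]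
    exact_mod_cast hpos.ne'
  -- The factor `b' * a - b * a'` is the numerator of `ω'`.
  have e : (a' + ε * b') / (a + ε * b) - (a' * conj a - b' * conj b) / (a * conj a - b * conj b) =
      (b' * a - b * a') * (conj b + ε * conj a) / ((a * conj a - b * conj b) * (a + ε * b)) := by
    field_simp
    ring
  rw [e, hJ]
  simp only [norm_div, norm_mul, norm_pow, Complex.norm_real, Real.norm_of_nonneg hpos.le]
  have h1 : 0 < ‖a‖ := norm_pos_iff.2 ha
  have h2 : 0 < ‖a + ε * b‖ := norm_pos_iff.2 hne
  have e2 : 1 - (‖b‖ / ‖a‖) ^ 2 = (‖a‖ ^ 2 - ‖b‖ ^ 2) / ‖a‖ ^ 2 := by field_simp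
  rw [e2]
  field_simp

theorem norm_preSchwarzian_sub_le (H : IsSensePreservingHarmonic f h g D) (hD : IsOpen D)
    {ε z : ℂ} (hε : ‖ε‖ ≤ 1) (hz : z ∈ D) :
    ‖preSchwarzian (fun w => h w + ε * g w) z - preSchwarzian f z‖ ≤
      ‖deriv (dilatation h g) z‖ / (1 - ‖dilatation h g z‖ ^ 2) := by
  rw [H.norm_preSchwarzian_sub hD hε hz]
  have h1 := H.norm_dilatation_lt_one hD hz
  refine mul_le_of_le_one_right (div_nonneg (norm_nonneg _) ?_) (div_le_one_of_le₀
    (norm_conj_add_mul_conj_le hε (H.norm_deriv_lt hD hz).le) (norm_nonneg _))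
  nlinarith [norm_nonneg (dilatation h g z)]

end IsSensePreservingHarmonic

end Formula

/-! ### Hyperbolic density and comparison of norms -/

/-- The density is evaluated at one chosen pair `(φ, w)`. The estimates hold for every conformal
map, so independence of the choice never has to be established. -/
theorem exists_isConformalDiskMap_inv_hyperbolicDensity_eq {D : Set ℂ} {z : ℂ}
    (h : ∃ p : (ℂ → ℂ) × ℂ, IsConformalDiskMap p.1 D ∧ p.2 ∈ ball (0 : ℂ) 1 ∧ p.1 p.2 = z) :
    ∃ (φ : ℂ → ℂ) (w : ℂ), IsConformalDiskMap φ D ∧ w ∈ ball (0 : ℂ) 1 ∧ φ w = z ∧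
      (hyperbolicDensity D z)⁻¹ = ‖deriv φ w‖ * (1 - ‖w‖ ^ 2) := by
  refine ⟨h.choose.1, h.choose.2, h.choose_spec.1, h.choose_spec.2.1, h.choose_spec.2.2, ?_⟩
  rw [hyperbolicDensity, dif_pos h, one_div, inv_inv, mul_comm]

theorem hyperbolicDensity_eq_zero {D : Set ℂ} {z : ℂ}
    (h : ¬∃ p : (ℂ → ℂ) × ℂ, IsConformalDiskMap p.1 D ∧ p.2 ∈ ball (0 : ℂ) 1 ∧ p.1 p.2 = z) :
    hyperbolicDensity D z = 0 := dif_neg h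

theorem inv_hyperbolicDensity_nonneg (D : Set ℂ) (z : ℂ) : 0 ≤ (hyperbolicDensity D z)⁻¹ := by
  by_cases h : ∃ p : (ℂ → ℂ) × ℂ, IsConformalDiskMap p.1 D ∧ p.2 ∈ ball (0 : ℂ) 1 ∧ p.1 p.2 = z
  · obtain ⟨φ, w, -, hw, -, e⟩ := exists_isConformalDiskMap_inv_hyperbolicDensity_eq h
    rw [e]
    have := mem_ball_zero_iff.1 hw
    exact mul_nonneg (norm_nonneg _) (by nlinarith [norm_nonneg w])
  · simp [hyperbolicDensity_eq_zero h]

theorem IsSensePreservingHarmonic.inv_hyperbolicDensity_mul_le {f h g : ℂ → ℂ} {D : Set ℂ}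
    (H : IsSensePreservingHarmonic f h g D) (hD : IsOpen D) {ε z : ℂ} (hε : ‖ε‖ ≤ 1) (hz : z ∈ D) :
    (hyperbolicDensity D z)⁻¹ *
      ‖preSchwarzian (fun w => h w + ε * g w) z - preSchwarzian f z‖ ≤ supDilatation h g D := by
  refine (mul_le_mul_of_nonneg_left (H.norm_preSchwarzian_sub_le hD hε hz)
    (inv_hyperbolicDensity_nonneg D z)).trans ?_
  by_cases hex : ∃ p : (ℂ → ℂ) × ℂ, IsConformalDiskMap p.1 D ∧ p.2 ∈ ball (0 : ℂ) 1 ∧ p.1 p.2 = z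
  · obtain ⟨φ, w, hφ, hw, rfl, e⟩ := exists_isConformalDiskMap_inv_hyperbolicDensity_eq hex
    have hωd : ∀ z ∈ D, DifferentiableAt ℂ (dilatation h g) z := fun z hz =>
      (H.hasDerivAt_dilatation hD hz).differentiableAt
    have hmaps := hφ.2.mapsTo
    have hd : DifferentiableOn ℂ (dilatation h g ∘ φ) (ball 0 1) :=
      DifferentiableOn.comp (t := D) (fun z hz => (hωd z hz).differentiableWithinAt) hφ.1 hmaps
    have key := norm_deriv_mul_le_mul_of_norm_le hd
      (fun ζ hζ => H.norm_dilatation_le_supDilatation hD (hmaps hζ))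
      (fun ζ hζ => H.norm_dilatation_lt_one hD (hmaps hζ)) hw
    rw [((hωd _ hz).hasDerivAt.comp w
      (hφ.1.differentiableAt (isOpen_ball.mem_nhds hw)).hasDerivAt).deriv, norm_mul] at key
    have h1 := H.norm_dilatation_lt_one hD hz
    have h2 : 0 < 1 - ‖dilatation h g (φ w)‖ ^ 2 := by
      nlinarith [norm_nonneg (dilatation h g (φ w))]
    rw [e, mul_div_assoc', div_le_iff₀ h2]
    calc _ = ‖deriv (dilatation h g) (φ w)‖ * ‖deriv φ w‖ * (1 - ‖w‖ ^ 2) := by ring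
      _ ≤ _ := key
  -- Without a conformal map the density takes the default value 0, whose inverse is 0, and the
  -- bound is trivial.
  · rw [hyperbolicDensity_eq_zero hex, inv_zero, zero_mul]
    exact (norm_nonneg _).trans (H.norm_dilatation_le_supDilatation hD hz)

theorem preSchwarzianNorm_le_add {f₁ f₂ : ℂ → ℂ} {D : Set ℂ} {M : ℝ}
    (h : ∀ z ∈ D, (hyperbolicDensity D z)⁻¹ * ‖preSchwarzian f₁ z - preSchwarzian f₂ z‖ ≤ M) :
    preSchwarzianNorm f₁ D ≤ preSchwarzianNorm f₂ D + ENNReal.ofReal M := by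
  refine iSup₂_le fun z hz => ?_
  have hl := inv_hyperbolicDensity_nonneg D z
  have h1 : (hyperbolicDensity D z)⁻¹ * ‖preSchwarzian f₁ z‖ ≤
      (hyperbolicDensity D z)⁻¹ * ‖preSchwarzian f₂ z‖ + M := by
    have h2 := norm_le_norm_add_norm_sub' (preSchwarzian f₁ z) (preSchwarzian f₂ z)
    nlinarith [h z hz, mul_le_mul_of_nonneg_left h2 hl]
  refine (ENNReal.ofReal_le_ofReal h1).trans (ENNReal.ofReal_add_le.trans ?_)
  gcongr
  exact le_iSup₂ (f := fun z (_ : z ∈ D) =>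
    ENNReal.ofReal ((hyperbolicDensity D z)⁻¹ * ‖preSchwarzian f₂ z‖)) z hz

theorem ENNReal.abs_toReal_sub_toReal_le {x y : ℝ≥0∞} {M : ℝ} (hM : 0 ≤ M)
    (h1 : x ≤ y + ENNReal.ofReal M) (h2 : y ≤ x + ENNReal.ofReal M) (hy : y < ⊤) :
    |x.toReal - y.toReal| ≤ M := by
  have hx : x < ⊤ := h1.trans_lt (ENNReal.add_lt_top.2 ⟨hy, ENNReal.ofReal_lt_top⟩)
  have key : ∀ {x y : ℝ≥0∞}, y ≠ ⊤ → x ≤ y + ENNReal.ofReal M → x.toReal ≤ y.toReal + M := by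
    intro x y hy h
    have := ENNReal.toReal_mono (ENNReal.add_ne_top.2 ⟨hy, ENNReal.ofReal_ne_top⟩) h
    rwa [ENNReal.toReal_add hy ENNReal.ofReal_ne_top, ENNReal.toReal_ofReal hM] at this
  rw [abs_sub_le_iff]
  exact ⟨by linarith [key hy.ne h1], by linarith [key hx.ne h2]⟩

/-- The Riemann mapping theorem rules out the default value of the density; precomposing the chosen
map with a disk automorphism sending 0 to `w` turns `|φ'(w)| (1 - |w|²)` into a derivative at 0. -/
theorem IsConformalDiskMap.exists_apply_zero_eq {D : Set ℂ} (hDo : IsOpen D)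
    (hDs : IsSimplyConnected D) (hD : D ≠ univ) {z : ℂ} (hz : z ∈ D) :
    ∃ φ : ℂ → ℂ, IsConformalDiskMap φ D ∧ φ 0 = z ∧
      (hyperbolicDensity D z)⁻¹ = ‖deriv φ 0‖ := by
  obtain ⟨f, hf, hfb⟩ := exists_bijOn_ball_of_isSimplyConnected hDo hDs hD
  have hex : ∃ p : (ℂ → ℂ) × ℂ, IsConformalDiskMap p.1 D ∧ p.2 ∈ ball (0 : ℂ) 1 ∧ p.1 p.2 = z := by
    refine ⟨(Function.invFunOn f D, f z), ⟨?_, ?_⟩, hfb.mapsTo hz,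
      hfb.injOn.leftInvOn_invFunOn hz⟩
    · have := hf.differentiableOn_leftInverse hDo hfb.injOn hfb.injOn.leftInvOn_invFunOn
      rwa [hfb.image_eq] at this
    · exact hfb.symm hfb.invOn_invFunOn.symm
  obtain ⟨φ, w, hφ, hw, hφw, e⟩ := exists_isConformalDiskMap_inv_hyperbolicDensity_eq hex
  have hw1 : ‖-w‖ < 1 := by simpa using hw
  have h0 : diskMobius (-w) 0 = w := by simp [diskMobius]
  refine ⟨φ ∘ diskMobius (-w), ⟨hφ.1.comp (differentiableOn_diskMobius hw1)
    (mapsTo_diskMobius hw1), hφ.2.comp (bijOn_diskMobius hw1)⟩, by simp [h0, hφw], ?_⟩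
  have h1 : HasDerivAt (diskMobius (-w)) (1 - (‖w‖ : ℂ) ^ 2) 0 := by
    simpa using hasDerivAt_diskMobius (a := -w) (z := 0) (by simp)
  have h2 : HasDerivAt φ (deriv φ w) (diskMobius (-w) 0) := by
    rw [h0]
    exact (hφ.1.differentiableAt (isOpen_ball.mem_nhds hw)).hasDerivAt
  have hpos : 0 < 1 - ‖w‖ ^ 2 := by
    have := mem_ball_zero_iff.1 hw
    nlinarith [norm_nonneg w]
  rw [e, (h2.comp 0 h1).deriv, norm_mul,
    show (1 - (‖w‖ : ℂ) ^ 2) = ((1 - ‖w‖ ^ 2 : ℝ) : ℂ) by push_cast; ring, Complex.norm_real,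
    Real.norm_of_nonneg hpos.le]

/-! ### Extremal mappings -/

theorem DifferentiableOn.isSensePreservingHarmonic {h g : ℂ → ℂ} {D : Set ℂ} (hD : IsOpen D)
    (hh : DifferentiableOn ℂ h D) (hg : DifferentiableOn ℂ g D)
    (hlt : ∀ z ∈ D, ‖_root_.deriv g z‖ < ‖_root_.deriv h z‖) :
    IsSensePreservingHarmonic (fun z => h z + conj (g z)) h g D where
  harmonic := fun z hz => by
    have h1 := (hh.analyticAt (hD.mem_nhds hz)).harmonicAt
    have h2 := (hg.analyticAt (hD.mem_nhds hz)).harmonicAt_conj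
    exact h1.add h2
  jacobian_pos := fun z hz => by
    rw [jacobian_eq hD hh hg (fun _ _ => rfl) hz]
    exact sub_pos.2 (pow_lt_pow_left₀ (hlt z hz) (norm_nonneg _) two_ne_zero)
  analytic_h := hh
  analytic_g := hg
  decomposition := fun _ _ => rfl

theorem sSup_image_norm_mul_ball {k : ℝ} (hk : 0 ≤ k) :
    sSup ((fun ζ : ℂ => ‖(k : ℂ) * ζ‖) '' ball 0 1) = k := by
  refine IsLUB.csSup_eq ⟨?_, fun M hM => ?_⟩ ⟨_, 0, by simp, rfl⟩
  · rintro _ ⟨ζ, hζ, rfl⟩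
    beta_reduce
    rw [norm_mul, Complex.norm_real, Real.norm_of_nonneg hk]
    exact mul_le_of_le_one_right hk (mem_ball_zero_iff.1 hζ).le
  · have h1 : ∀ t : ℝ, 0 ≤ t → t < 1 → k * t ≤ M := fun t ht ht1 => by
      have := hM ⟨(t : ℂ), by simpa [abs_of_nonneg ht] using ht1, rfl⟩
      simpa [abs_of_nonneg ht, abs_of_nonneg hk] using this
    have h2 : Tendsto (fun t : ℝ => k * t) (𝓝[<] 1) (𝓝 k) := by
      have : Tendsto (fun t : ℝ => k * t) (𝓝 1) (𝓝 (k * 1)) :=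
        tendsto_id.const_mul k
      rw [mul_one] at this
      exact this.mono_left nhdsWithin_le_nhds
    refine le_of_tendsto h2 ?_
    filter_upwards [Ioo_mem_nhdsLT zero_lt_one] with t ht using h1 t ht.1.le ht.2

/-- The conditions `H' + G' = 1` and `G' = ω H'` force `H' = 1 / (1 + ω)`. Pulled back by `φ`, this
asks for a primitive `K` of `φ' / (1 + kζ)` on the disk; then `H = K ∘ φ⁻¹` and `G = z - H`. -/
theorem IsConformalDiskMap.exists_isSensePreservingHarmonic {φ : ℂ → ℂ} {D : Set ℂ}
    (hφ : IsConformalDiskMap φ D) {k : ℝ} (hk : k ∈ Icc (0 : ℝ) 1) :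
    ∃ H G : ℂ → ℂ, IsSensePreservingHarmonic (fun z => H z + conj (G z)) H G D ∧
      supDilatation H G D = k ∧ (∀ z, H z + G z = z) ∧
      ∀ ζ ∈ ball (0 : ℂ) 1, dilatation H G (φ ζ) = k * ζ := by
  have hi := hφ.2.injOn
  have hD : IsOpen D := hφ.2.image_eq ▸ hφ.1.isOpen_image_of_injOn isOpen_ball hi
  have hne : ∀ ζ ∈ ball (0 : ℂ) 1, 1 + (k : ℂ) * ζ ≠ 0 := by
    intro ζ hζ h0
    have h1 : ‖(k : ℂ) * ζ‖ = 1 := by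
      rw [← norm_neg, ← eq_neg_of_add_eq_zero_left h0, norm_one]
    rw [norm_mul, Complex.norm_real, Real.norm_of_nonneg hk.1] at h1
    nlinarith [hk.2, hk.1, mem_ball_zero_iff.1 hζ, norm_nonneg ζ]
  obtain ⟨K, hK⟩ : Complex.IsExactOn (fun ζ => deriv φ ζ / (1 + k * ζ)) (ball 0 1) :=
    ((hφ.1.deriv isOpen_ball).div ((differentiableOn_id.const_mul _).const_add _)
      hne).isExactOn_ball
  set ψ := Function.invFunOn φ (ball 0 1)
  have hψ : LeftInvOn ψ φ (ball 0 1) := hi.leftInvOn_invFunOn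
  have hψd : DifferentiableOn ℂ ψ D := by
    have := hφ.1.differentiableOn_leftInverse isOpen_ball hi hψ
    rwa [hφ.2.image_eq] at this
  have hH : ∀ ζ ∈ ball (0 : ℂ) 1, HasDerivAt (K ∘ ψ) (1 + k * ζ)⁻¹ (φ ζ) := by
    intro ζ hζ
    have h1 : HasDerivAt K (deriv φ ζ / (1 + k * ζ)) (ψ (φ ζ)) := by
      rw [hψ hζ]
      exact hK ζ hζ
    have h2 := h1.comp (φ ζ) (hψd.differentiableAt (hD.mem_nhds (hφ.2.mapsTo hζ))).hasDerivAt
    refine h2.congr_deriv ?_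
    have h3 := hφ.1.deriv_leftInverse_mul isOpen_ball hi hψ hζ
    rw [div_mul_eq_mul_div, mul_comm (deriv φ ζ), h3, one_div]
  have hG : ∀ ζ ∈ ball (0 : ℂ) 1,
      HasDerivAt (fun z => z - (K ∘ ψ) z) (k * ζ * (1 + k * ζ)⁻¹) (φ ζ) := by
    intro ζ hζ
    refine ((hasDerivAt_id (φ ζ)).sub (hH ζ hζ)).congr_deriv ?_
    have := hne ζ hζ
    field_simp
    ring
  have hdil : ∀ ζ ∈ ball (0 : ℂ) 1,
      dilatation (K ∘ ψ) (fun z => z - (K ∘ ψ) z) (φ ζ) = k * ζ := by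
    intro ζ hζ
    rw [dilatation, (hH ζ hζ).deriv, (hG ζ hζ).deriv,
      mul_div_cancel_right₀ _ (inv_ne_zero (hne ζ hζ))]
  refine ⟨K ∘ ψ, fun z => z - (K ∘ ψ) z,
    DifferentiableOn.isSensePreservingHarmonic hD ?_ ?_ ?_, ?_, by simp, hdil⟩
  · intro z hz
    obtain ⟨ζ, hζ, rfl⟩ := hφ.2.surjOn hz
    exact (hH ζ hζ).differentiableAt.differentiableWithinAt
  · intro z hz
    obtain ⟨ζ, hζ, rfl⟩ := hφ.2.surjOn hz
    exact (hG ζ hζ).differentiableAt.differentiableWithinAt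
  · intro z hz
    obtain ⟨ζ, hζ, rfl⟩ := hφ.2.surjOn hz
    rw [(hH ζ hζ).deriv, (hG ζ hζ).deriv, norm_mul]
    refine mul_lt_of_lt_one_left (norm_pos_iff.2 (inv_ne_zero (hne ζ hζ))) ?_
    rw [norm_mul, Complex.norm_real, Real.norm_of_nonneg hk.1]
    nlinarith [hk.2, hk.1, mem_ball_zero_iff.1 hζ, norm_nonneg ζ]
  · rw [supDilatation, ← hφ.2.image_eq, image_image, ← sSup_image_norm_mul_ball hk.1]
    congr 1
    exact image_congr fun ζ hζ => by rw [hdil ζ hζ]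

theorem preSchwarzian_id (z : ℂ) : preSchwarzian (fun w => w) z = 0 := by
  have h := preSchwarzian_eq (f := fun w => w) (h := fun w => w) (g := fun _ => 0) isOpen_univ
    differentiableOn_id (differentiableOn_const 0) (by simp) (mem_univ z) (by simp)
  rw [h]
  simp

/-! ### The main theorem -/

theorem theorem4 (D : Set ℂ) (hDo : IsOpen D) (hDs : IsSimplyConnected D) (hD : D ≠ univ) :
    (∀ f h g : ℂ → ℂ, IsSensePreservingHarmonic f h g D →
      ∀ ε ∈ closedBall (0 : ℂ) 1,
        (∀ z ∈ D, (hyperbolicDensity D z)⁻¹ *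
            ‖preSchwarzian (fun w => h w + ε * g w) z - preSchwarzian f z‖
              ≤ supDilatation h g D) ∧
        ((preSchwarzianNorm (fun w => h w + ε * g w) D = ⊤ ∧ preSchwarzianNorm f D = ⊤) ∨
          (preSchwarzianNorm (fun w => h w + ε * g w) D < ⊤ ∧ preSchwarzianNorm f D < ⊤)) ∧
        (preSchwarzianNorm f D < ⊤ →
          |(preSchwarzianNorm (fun w => h w + ε * g w) D).toReal - (preSchwarzianNorm f D).toReal|
            ≤ supDilatation h g D)) ∧
    (∀ k ∈ Icc (0 : ℝ) 1, ∃ ε ∈ closedBall (0 : ℂ) 1, ∃ F H G : ℂ → ℂ,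
      IsSensePreservingHarmonic F H G D ∧
      supDilatation H G D = k ∧
      (∃ z ∈ D, (hyperbolicDensity D z)⁻¹ *
          ‖preSchwarzian (fun w => H w + ε * G w) z - preSchwarzian F z‖ = k) ∧
      ((∃ (c : ℂ) (r : ℝ), 0 < r ∧ D = ball c r) →
        preSchwarzianNorm (fun w => H w + ε * G w) D < ⊤ ∧
        preSchwarzianNorm F D < ⊤ ∧
        |(preSchwarzianNorm (fun w => H w + ε * G w) D).toReal - (preSchwarzianNorm F D).toReal|
          = k)) := by
  obtain ⟨z₀, hz₀⟩ := hDs.nonempty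
  constructor
  · intro f h g H ε hε
    rw [mem_closedBall_zero_iff] at hε
    have hM : 0 ≤ supDilatation h g D :=
      (norm_nonneg _).trans (H.norm_dilatation_le_supDilatation hDo hz₀)
    have key := fun z (hz : z ∈ D) => H.inv_hyperbolicDensity_mul_le hDo hε hz
    have h1 := preSchwarzianNorm_le_add key
    have h2 := preSchwarzianNorm_le_add (f₁ := f) (f₂ := fun w => h w + ε * g w)
      (fun z hz => by rw [norm_sub_rev]; exact key z hz)
    refine ⟨key, ?_, ENNReal.abs_toReal_sub_toReal_le hM h1 h2⟩
    rcases eq_or_ne (preSchwarzianNorm f D) ⊤ with hf | hf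
    · left
      rw [hf, top_le_iff, ENNReal.add_eq_top] at h2
      exact ⟨h2.resolve_right ENNReal.ofReal_ne_top, hf⟩
    · right
      have hf' := lt_top_iff_ne_top.2 hf
      exact ⟨h1.trans_lt (ENNReal.add_lt_top.2 ⟨hf', ENNReal.ofReal_lt_top⟩), hf'⟩
  · intro k hk
    obtain ⟨φ, hφ, hφ0, hdens⟩ := IsConformalDiskMap.exists_apply_zero_eq hDo hDs hD hz₀
    obtain ⟨H, G, hF, hsup, hadd, hdil⟩ := hφ.exists_isSensePreservingHarmonic hk
    have h0mem : (0 : ℂ) ∈ ball (0 : ℂ) 1 := mem_ball_self one_pos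
    have hε : ‖(1 : ℂ)‖ ≤ 1 := norm_one.le
    have heq : (hyperbolicDensity D z₀)⁻¹ * ‖preSchwarzian (fun w => H w + 1 * G w) z₀ -
        preSchwarzian (fun z => H z + conj (G z)) z₀‖ = k := by
      have hω0 : dilatation H G z₀ = 0 := by rw [← hφ0, hdil 0 h0mem, mul_zero]
      have hder : deriv (dilatation H G) z₀ * deriv φ 0 = k := by
        have h1 : HasDerivAt (dilatation H G) (deriv (dilatation H G) z₀) (φ 0) := by
          rw [hφ0]
          exact (hF.hasDerivAt_dilatation hDo hz₀).differentiableAt.hasDerivAt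
        have h2 := h1.comp 0
          (hφ.1.differentiableAt (isOpen_ball.mem_nhds h0mem)).hasDerivAt
        have h3 : HasDerivAt (dilatation H G ∘ φ) (k : ℂ) 0 := by
          have h4 : HasDerivAt (fun ζ : ℂ => (k : ℂ) * ζ) (k : ℂ) 0 := by
            simpa using (hasDerivAt_id (0 : ℂ)).const_mul (k : ℂ)
          refine h4.congr_of_eventuallyEq ?_
          filter_upwards [isOpen_ball.mem_nhds h0mem] with ζ hζ using hdil ζ hζ
        exact h2.unique h3
      -- For `ε = 1` the numerator is the conjugate of the denominator, so nothing is lost in this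
      -- factor.
      have hunit : ‖conj (deriv G z₀) + 1 * conj (deriv H z₀)‖ / ‖deriv H z₀ + 1 * deriv G z₀‖
          = 1 := by
        rw [one_mul, one_mul, ← map_add, RCLike.norm_conj, add_comm, div_self]
        simpa using hF.add_mul_deriv_ne_zero hDo hε hz₀
      rw [hF.norm_preSchwarzian_sub hDo hε hz₀, hunit, hω0, hdens, mul_comm]
      simp only [norm_zero, ne_eq, OfNat.ofNat_ne_zero, not_false_eq_true, zero_pow, sub_zero,
        div_one, mul_one]
      rw [← norm_mul, hder, Complex.norm_real, Real.norm_of_nonneg hk.1]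
    have hid : (fun w => H w + 1 * G w) = fun w => w := by
      ext w
      rw [one_mul, hadd]
    have hn0 : preSchwarzianNorm (fun w => H w + 1 * G w) D = 0 := by
      rw [hid]
      simp [preSchwarzianNorm, preSchwarzian_id]
    -- Since `P_{H+G} = 0`, the pointwise bound gives `‖P_F‖ ≤ k`, and equality at `z₀` gives the
    -- reverse.
    have hnF : preSchwarzianNorm (fun z => H z + conj (G z)) D = ENNReal.ofReal k := by
      refine le_antisymm ?_ ?_
      · have := preSchwarzianNorm_le_add (f₁ := fun z => H z + conj (G z))
          (f₂ := fun w => H w + 1 * G w) (fun z hz => by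
            rw [norm_sub_rev]
            exact hF.inv_hyperbolicDensity_mul_le hDo hε hz)
        rwa [hn0, zero_add, hsup] at this
      · rw [hid, preSchwarzian_id, zero_sub, norm_neg] at heq
        rw [← heq]
        exact le_iSup₂ (f := fun z (_ : z ∈ D) => ENNReal.ofReal ((hyperbolicDensity D z)⁻¹ *
          ‖preSchwarzian (fun z => H z + conj (G z)) z‖)) z₀ hz₀
    refine ⟨1, by simp, fun z => H z + conj (G z), H, G, hF, hsup, ⟨z₀, hz₀, heq⟩, fun _ => ?_⟩
    rw [hn0, hnF]
    refine ⟨ENNReal.zero_lt_top, ENNReal.ofReal_lt_top, ?_⟩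
    rw [ENNReal.toReal_zero, ENNReal.toReal_ofReal hk.1, zero_sub, abs_neg, abs_of_nonneg hk.1]
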